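/- Consider randomized benchmarking of a single qubit with the single-qubit Clifford group $\mathcal{C}_2$ (the normalizer of the Pauli group in $\mathsf{U}(2)$, modulo global phases). For $m\ge 0$ choose $g_1,\dots,g_m\in\mathcal{C}_2$ independently and uniformly at random and set $g_0=(g_m\cdots g_1)^{-1}$. Prepare a state $\rho$, apply successively $g_0,g_1,\dots,g_m$, where the gate $g_t$ is preceded by a noise channel (a completely positive trace-preserving map): a channel $\Lambda_0$ for $t=0$, and one and the same gate- and time-independent channel $\Lambda$ for $t=1,\dots,m$ (the choice $\Lambda_0=\Lambda$ being allowed). Then measure $\{E,\mathbb{1}-E\}$ with $0\le E\le\mathbb{1}$. For the sequence $s=(g_1,\dots,g_m)$ let $$F_{m,s}=\operatorname{Tr}\bigl[E\,(g_m\Lambda\cdots g_1\Lambda\, g_0\Lambda_0)(\rho)\bigr]$$ be the probability of the outcome $E$, where $g_t$ stands for conjugation by $g_t$, and let $\sigma_m^2$ be the variance of $F_{m,s}$ over the uniformly random sequence $s$. Let $r=1-\int \mathrm{d}\psi\,\operatorname{Tr}[\psi\,\Lambda(\psi)]$ be the average gate infidelity of $\Lambda$, the integral being over the uniform (unitarily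 invariant) probability measure on pure states. Suppose that the unital block of $\Lambda$ is diagonal in the Pauli basis, i.e. $\operatorname{Tr}[P\,\Lambda(Q)]=0$ for all distinct $P,Q\in\{X,Y,Z\}$ ($\Lambda$ itself need not be unital). Then $$\sigma_m^2\le \tfrac{11}{4}\,m r^2+O(m^2r^3),$$ that is, there is an absolute constant $C$, independent of $\Lambda$, $\Lambda_0$, $m$, $\rho$ and $E$, such that $\sigma_m^2\le\tfrac{11}{4}mr^2+C\,m^2r^3$ for every such $\Lambda$, every $\Lambda_0$, every $m\ge 0$, every state $\rho$ and every effect $E$. -/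

import Mathlib

open scoped ComplexOrder BigOperators

noncomputable section

namespace RandomizedBenchmarking

/-- Operators on a single qubit. -/
abbrev Op : Type := Matrix (Fin 2) (Fin 2) ℂ

/-- Superoperators: linear maps on qubit operators; the product is composition. -/
abbrev SuperOp : Type := Module.End ℂ Op

/-- The Pauli matrices `1, X, Y, Z`. -/
def pauli : Fin 4 → Op :=
  ![1, !![0, 1; 1, 0], !![0, -Complex.I; Complex.I, 0], !![1, 0; 0, -1]]

/-! ### States, effects and channels -/

/-- Density operators. -/
structure IsState (ρ : Op) : Prop where
  posSemidef : ρ.PosSemidef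
  trace_eq_one : ρ.trace = 1

/-- Measurement effects: `{E, 1 - E}` is a POVM. -/
structure IsEffect (E : Op) : Prop where
  posSemidef : E.PosSemidef
  one_sub_posSemidef : (1 - E).PosSemidef

/-- The ampliation `id_k ⊗ Λ`, acting on `k × k` block matrices with qubit-operator blocks. -/
def ampliation (Λ : SuperOp) (k : ℕ) (A : Matrix (Fin k × Fin 2) (Fin k × Fin 2) ℂ) :
    Matrix (Fin k × Fin 2) (Fin k × Fin 2) ℂ :=
  Matrix.of fun p q => Λ (Matrix.of fun a b => A (p.1, a) (q.1, b)) p.2 q.2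

/-- Completely positive and trace-preserving maps. -/
structure IsCPTP (Λ : SuperOp) : Prop where
  completelyPositive : ∀ (k : ℕ) (A : Matrix (Fin k × Fin 2) (Fin k × Fin 2) ℂ),
    A.PosSemidef → (ampliation Λ k A).PosSemidef
  trace_map : ∀ A : Op, (Λ A).trace = A.trace

/-- The pure state `|ψ⟩⟨ψ|` of a unit vector `ψ`. -/
def pureState (ψ : Metric.sphere (0 : EuclideanSpace ℂ (Fin 2)) 1) : Op :=
  Matrix.vecMulVec (fun i => (ψ : EuclideanSpace ℂ (Fin 2)) i)
    (star fun i => (ψ : EuclideanSpace ℂ (Fin 2)) i)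

/-- The average gate fidelity `∫ dψ Tr[ψ Λ(ψ)]`, the average being taken with respect to the
normalized unitarily invariant (uniform) measure on the unit sphere of `ℂ²`. -/
def avgFidelity (Λ : SuperOp) : ℝ :=
  ⨍ ψ : Metric.sphere (0 : EuclideanSpace ℂ (Fin 2)) 1,
    (pureState ψ * Λ (pureState ψ)).trace.re
      ∂(MeasureTheory.volume : MeasureTheory.Measure (EuclideanSpace ℂ (Fin 2))).toSphere

/-- The average gate infidelity `r`. -/
def infidelity (Λ : SuperOp) : ℝ := 1 - avgFidelity Λ

/-- The trace-orthonormal Pauli basis `(1, X, Y, Z) / √2`. -/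
def pauliBasis (j : Fin 4) : Op := ((Real.sqrt 2 : ℝ) : ℂ)⁻¹ • pauli j

/-- The Liouville representation in the Pauli basis: the `(j, k)` entry is
`⟨A_j, Λ(A_k)⟩ = Tr(A_j† Λ(A_k))`. -/
def liouville (Λ : SuperOp) : Matrix (Fin 4) (Fin 4) ℂ :=
  Matrix.of fun j k => ((pauliBasis j).conjTranspose * Λ (pauliBasis k)).trace

/-- The unital block: the part of the Liouville matrix on the traceless operators `X, Y, Z`. -/
def unitalBlock (Λ : SuperOp) : Matrix (Fin 3) (Fin 3) ℂ :=
  (liouville Λ).submatrix Fin.succ Fin.succ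

/-! ### The single-qubit Clifford group -/

/-- The single-qubit Pauli group, generated by the Pauli matrices inside `U(2)`. -/
def pauliGroup : Subgroup (Matrix.unitaryGroup (Fin 2) ℂ) :=
  Subgroup.closure {U | ∃ j, (U : Op) = pauli j}

/-- The single-qubit Clifford group: the normalizer of the Pauli group in `U(2)`, global phases
being removed by passing to the unitary channels `A ↦ U A U†`. -/
def cliffordGroup : Subgroup (Op ≃⋆ₐ[ℂ] Op) :=
  (Subgroup.normalizer (pauliGroup : Set (Matrix.unitaryGroup (Fin 2) ℂ))).map
    (Unitary.conjStarAlgAut ℂ Op)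

theorem pauliGroup_coe_mem (U : Matrix.unitaryGroup (Fin 2) ℂ) (hU : U ∈ pauliGroup) :
    ∃ (n : Fin 4) (j : Fin 4), (U : Op) = Complex.I ^ (n : ℕ) • pauli j := by
  have hmul : ∀ i j : Fin 4, ∃ n l : Fin 4,
      pauli i * pauli j = Complex.I ^ (n : ℕ) • pauli l := by
    have key : ∀ i j : Fin 4, pauli i * pauli j =
        Complex.I ^ (((!![0, 0, 0, 0; 0, 0, 1, 3; 0, 3, 0, 1; 0, 1, 3, 0] :
          Matrix (Fin 4) (Fin 4) (Fin 4)) i j : Fin 4) : ℕ) •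
        pauli ((!![0, 1, 2, 3; 1, 0, 3, 2; 2, 3, 0, 1; 3, 2, 1, 0] :
          Matrix (Fin 4) (Fin 4) (Fin 4)) i j) := by
      intro i j
      fin_cases i <;> fin_cases j <;> ext a b <;> fin_cases a <;> fin_cases b <;>
        simp [pauli, Complex.I_pow_three]
    exact fun i j => ⟨_, _, key i j⟩
  have hpow : ∀ n : ℕ, ∃ k : Fin 4, Complex.I ^ n = Complex.I ^ (k : ℕ) := fun n =>
    ⟨⟨n % 4, Nat.mod_lt _ (by norm_num)⟩, (Complex.I_pow_eq_pow_mod n)⟩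
  induction hU using Subgroup.closure_induction with
  | mem x hx =>
    obtain ⟨j, hj⟩ := hx
    exact ⟨0, j, by simp [hj]⟩
  | one => exact ⟨0, 0, by simp [pauli]⟩
  | mul x y _ _ hx hy =>
    obtain ⟨n, i, hx⟩ := hx
    obtain ⟨p, j, hy⟩ := hy
    obtain ⟨q, l, hl⟩ := hmul i j
    obtain ⟨k, hk⟩ := hpow (p + n + q)
    refine ⟨k, l, ?_⟩
    rw [← hk]
    simp [hx, hy, hl, smul_smul, pow_add, mul_assoc]
  | inv x _ hx =>
    obtain ⟨n, i, hx⟩ := hx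
    have hstar : star (pauli i) = pauli i := by
      fin_cases i <;> ext a b <;> fin_cases a <;> fin_cases b <;>
        simp [pauli, Matrix.star_apply]
    obtain ⟨k, hk⟩ := hpow (3 * n)
    refine ⟨k, i, ?_⟩
    rw [← hk, pow_mul, Complex.I_pow_three]
    simp [hx, star_smul, hstar]

theorem cliffordGroup_finite : Finite cliffordGroup := by
  let T : Set Op := Set.range fun p : Fin 4 × Fin 4 => Complex.I ^ (p.1 : ℕ) • pauli p.2
  have hT : T.Finite := Set.finite_range _
  have hmem : ∀ (g : cliffordGroup) (j : Fin 4), (g : Op ≃⋆ₐ[ℂ] Op) (pauli j) ∈ T := by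
    rintro ⟨g, U, hU, rfl⟩ j
    have hj : pauli j ∈ Matrix.unitaryGroup (Fin 2) ℂ := by
      rw [Matrix.mem_unitaryGroup_iff]
      fin_cases j <;> ext a b <;> fin_cases a <;> fin_cases b <;>
        simp [pauli, Matrix.star_apply, Matrix.mul_apply, Matrix.one_apply]
    have h1 : (⟨pauli j, hj⟩ : Matrix.unitaryGroup (Fin 2) ℂ) ∈ pauliGroup :=
      Subgroup.subset_closure ⟨j, rfl⟩
    obtain ⟨n, l, h⟩ := pauliGroup_coe_mem _ ((hU _).1 h1)
    exact ⟨(n, l), h.symm⟩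
  have : Finite T := hT
  refine Finite.of_injective
    (fun (g : cliffordGroup) (j : Fin 4) => (⟨_, hmem g j⟩ : T)) ?_
  intro g h hgh
  have hj : ∀ j, (g : Op ≃⋆ₐ[ℂ] Op) (pauli j) = (h : Op ≃⋆ₐ[ℂ] Op) (pauli j) := fun j =>
    congrArg Subtype.val (congrFun hgh j)
  refine Subtype.ext (StarAlgEquiv.ext fun A => ?_)
  have hA : A = ((A 0 0 + A 1 1) / 2) • pauli 0 + ((A 0 1 + A 1 0) / 2) • pauli 1 +
      (Complex.I * (A 0 1 - A 1 0) / 2) • pauli 2 + ((A 0 0 - A 1 1) / 2) • pauli 3 := by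
    ext a b
    fin_cases a <;> fin_cases b <;> simp [pauli] <;> ring_nf <;> simp <;> ring
  rw [hA]
  simp only [map_add, map_smul, hj]

instance : Fintype cliffordGroup :=
  haveI := cliffordGroup_finite
  Fintype.ofFinite _

/-- A Clifford gate as a superoperator. -/
def gate (g : cliffordGroup) : SuperOp where
  toFun A := (g : Op ≃⋆ₐ[ℂ] Op) A
  map_add' := map_add _
  map_smul' c A := map_smul (g : Op ≃⋆ₐ[ℂ] Op) c A

/-! ### The randomized benchmarking experiment -/

/-- The gates `g_0, g_1, …, g_m` of the sequence `s = (g_1, …, g_m)`, where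
`g_0 = (g_m ⋯ g_1)⁻¹`, so that `g_m ⋯ g_1 g_0 = 1`. -/
def gates {m : ℕ} (s : Fin m → cliffordGroup) : Fin (m + 1) → cliffordGroup :=
  Fin.cons (List.ofFn s).reverse.prod⁻¹ s

/-- The operation `(g_m Λ_m) ⋯ (g_1 Λ_1) (g_0 Λ_0)` applied to the system. -/
def sequenceOp {m : ℕ} (noise : Fin (m + 1) → SuperOp) (s : Fin m → cliffordGroup) : SuperOp :=
  (List.ofFn fun t => gate (gates s t) * noise t).reverse.prod

/-- The probability `F_{m,s} = p(E | s, ρ)` of the outcome `E` for the sequence `s`. -/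
def survivalProb {m : ℕ} (noise : Fin (m + 1) → SuperOp) (ρ E : Op)
    (s : Fin m → cliffordGroup) : ℝ :=
  (E * sequenceOp noise s ρ).trace.re

/-- The mean of `F_{m,s}` over uniformly random sequences `s` of length `m`. -/
def rbMean {m : ℕ} (noise : Fin (m + 1) → SuperOp) (ρ E : Op) : ℝ :=
  Finset.expect Finset.univ fun s : Fin m → cliffordGroup => survivalProb noise ρ E s

/-- The variance `σ_m²` of `F_{m,s}` over uniformly random sequences `s` of length `m`. -/
def rbVariance {m : ℕ} (noise : Fin (m + 1) → SuperOp) (ρ E : Op) : ℝ :=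
  Finset.expect Finset.univ fun s : Fin m → cliffordGroup =>
    (survivalProb noise ρ E s - rbMean noise ρ E) ^ 2

/-- Time-independent noise `Λ` at the steps `1, …, m`, with `Λ₀` at the initial step `0`. -/
def constNoise (m : ℕ) (Λ₀ Λ : SuperOp) : Fin (m + 1) → SuperOp :=
  Fin.cons Λ₀ fun _ => Λ

end RandomizedBenchmarking

end

/-! Since the gates multiply to the identity, commuting them through the noise turns a sequence into
a product of `m` twirled channels `g⁻¹ Λ g` acting on `Λ₀ ρ`, with independent uniform `g`
(`alignedOp_cons`, `expect_alignedOp_succ`). A Clifford gate permutes `X, Y, Z` up to sign, so for a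
diagonal unital block `d` and a translation `α` one twirl acts on Bloch vectors by `x i ↦ d (π i) *
x i ± α (π i)` (`twirl_apply_bloch`).

Averages over such signed permutations close on very few moments: `x i` is scaled by `p`, the mean
of `d`; `x i ^ 2` is scaled by `s`, the mean of `d ^ 2`, and gains the mean of `α ^ 2`; `x i * x j`
with `i ≠ j` is scaled by `q`, the mean of the products of two distinct `d`'s. As the survival
probability is affine in the Bloch vector, induction on `m` gives its variance exactly
(`rbVariance_eq`): terms in `s ^ m - p ^ (2 * m)` and `q ^ m - p ^ (2 * m)`, and a geometric sum
weighted by the mean of `α ^ 2`.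

Everything is then quadratic in the infidelity `r = (3 - ∑ d) / 6` (`infidelity_eq`). Complete
positivity gives `|α k| ≤ 1 - d k` and triangle inequalities between the numbers `1 - d k`
(`IsDiagonal.constraints`), hence `s - p² ≤ 2r²`, `|q - p²| ≤ r²` and a mean of `α ^ 2` at most
`6r²` (`IsDiagonal.moment_bounds`). The weights of these terms are at most `1/4`, so the variance is
at most `(2 + 1 + 6)/4 * m * r²`, below the claimed bound with no cubic term. -/

open scoped ComplexOrder BigOperators

noncomputable section

namespace RandomizedBenchmarking

open MeasureTheory
open scoped Pointwise

/-! ### Bloch vectors -/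

/-- The traceless Pauli matrices `X, Y, Z`. -/
def sigma (k : Fin 3) : Op := pauli k.succ

/-- The Hermitian operator of trace one with Bloch vector `x`. -/
def bloch (x : Fin 3 → ℝ) : Op := (1 / 2 : ℂ) • (1 + ∑ k, (x k : ℂ) • sigma k)

/-- The `k`-th Bloch coordinate of an operator. -/
def coord (k : Fin 3) (A : Op) : ℝ := (sigma k * A).trace.re

theorem sigma_zero : sigma 0 = !![0, 1; 1, 0] := rfl

theorem sigma_one : sigma 1 = !![0, -Complex.I; Complex.I, 0] := rfl

theorem sigma_two : sigma 2 = !![1, 0; 0, -1] := rfl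

theorem bloch_eq (x : Fin 3 → ℝ) :
    bloch x = !![(1 + x 2 : ℂ) / 2, (x 0 - x 1 * Complex.I) / 2;
      (x 0 + x 1 * Complex.I) / 2, (1 - x 2) / 2] := by
  ext a b
  fin_cases a <;> fin_cases b <;>
    simp [bloch, Fin.sum_univ_three, sigma_zero, sigma_one, sigma_two] <;> ring

theorem coord_zero (A : Op) : coord 0 A = (A 0 1).re + (A 1 0).re := by
  simp [coord, sigma_zero, Matrix.trace_fin_two, Matrix.vecMul, dotProduct, Fin.sum_univ_two]
  ring

theorem coord_one (A : Op) : coord 1 A = (A 1 0).im - (A 0 1).im := by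
  simp [coord, sigma_one, Matrix.trace_fin_two, Matrix.vecMul, dotProduct, Fin.sum_univ_two]
  ring

theorem coord_two (A : Op) : coord 2 A = (A 0 0).re - (A 1 1).re := by
  simp [coord, sigma_two, Matrix.trace_fin_two, Matrix.vecMul, dotProduct, Fin.sum_univ_two]
  ring

theorem eq_bloch_of_isHermitian {A : Op} (hA : A.IsHermitian) (htr : A.trace = 1) :
    A = bloch fun k => coord k A := by
  have h00 := congrArg Complex.im (hA.apply 0 0)
  have h11 := congrArg Complex.im (hA.apply 1 1)
  have h01r := congrArg Complex.re (hA.apply 0 1)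
  have h01i := congrArg Complex.im (hA.apply 0 1)
  have ht := congrArg Complex.re htr
  simp [Matrix.trace_fin_two] at h00 h11 h01r h01i ht
  rw [bloch_eq]
  ext a b
  fin_cases a <;> fin_cases b <;> apply Complex.ext <;>
    simp [coord_zero, coord_one, coord_two] <;> linarith

theorem trace_bloch_mul_bloch (x y : Fin 3 → ℝ) :
    (bloch x * bloch y).trace.re = (1 + ∑ k, x k * y k) / 2 := by
  simp [bloch_eq, Matrix.trace_fin_two, Fin.sum_univ_three]
  ring

theorem trace_mul_bloch {E : Op} (hE : E.IsHermitian) (x : Fin 3 → ℝ) :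
    (E * bloch x).trace.re = E.trace.re / 2 + ∑ k, coord k E / 2 * x k := by
  have h00 := congrArg Complex.im (hE.apply 0 0)
  have h11 := congrArg Complex.im (hE.apply 1 1)
  have h01r := congrArg Complex.re (hE.apply 0 1)
  have h01i := congrArg Complex.im (hE.apply 0 1)
  simp at h00 h11 h01r h01i
  simp [bloch_eq, Matrix.trace_fin_two, Matrix.mul_apply, Fin.sum_univ_two, Fin.sum_univ_three,
    coord_zero, coord_one, coord_two, h01r]
  ring

/-- The Bloch vector of a positive semidefinite operator is at most as long as its trace. -/
theorem sum_coord_sq_le {A : Op} (hA : A.PosSemidef) :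
    0 ≤ A.trace.re ∧ ∑ k, coord k A ^ 2 ≤ A.trace.re ^ 2 := by
  have hH := hA.isHermitian
  have h00 := congrArg Complex.im (hH.apply 0 0)
  have h11 := congrArg Complex.im (hH.apply 1 1)
  have h01r := congrArg Complex.re (hH.apply 0 1)
  have h01i := congrArg Complex.im (hH.apply 0 1)
  have hdet := (Complex.le_def.1 hA.det_nonneg).1
  have htr := (Complex.le_def.1 hA.trace_nonneg).1
  simp [Matrix.trace_fin_two, Matrix.det_fin_two] at h00 h11 h01r h01i hdet htr
  refine ⟨by simpa [Matrix.trace_fin_two] using htr, ?_⟩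
  simp [Matrix.trace_fin_two, Fin.sum_univ_three, coord_zero, coord_one, coord_two]
  -- For Hermitian `A` the squared trace minus the squared length of the coordinate vector is `4 det
  -- A`.
  have h0 : (A 0 0).im = 0 := by linarith
  rw [h01r] at *
  nlinarith [h01i]

/-! ### Conjugation by Pauli matrices and by the three-cycle of the Pauli matrices -/

/-- The sign of `σ_k` under conjugation by the Pauli matrix `a`. -/
def pauliSign : Matrix (Fin 4) (Fin 3) ℝ := !![1, 1, 1; 1, -1, -1; -1, 1, -1; -1, -1, 1]

theorem pauli_conj_sigma (a : Fin 4) (k : Fin 3) :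
    pauli a * sigma k * star (pauli a) = (pauliSign a k : ℂ) • sigma k := by
  fin_cases a <;> fin_cases k <;> ext i j <;> fin_cases i <;> fin_cases j <;>
    simp [pauliSign, sigma, pauli, Matrix.star_apply, Matrix.mul_apply, Fin.sum_univ_two]

theorem pauli_mem_unitaryGroup (a : Fin 4) : pauli a ∈ Matrix.unitaryGroup (Fin 2) ℂ := by
  rw [Matrix.mem_unitaryGroup_iff]
  fin_cases a <;> ext i j <;> fin_cases i <;> fin_cases j <;>
    simp [pauli, Matrix.star_apply, Matrix.mul_apply, Matrix.one_apply]

/-- A Clifford unitary permuting `X, Y, Z` cyclically. -/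
def cycle : Op := (1 / 2 : ℂ) • !![1 - Complex.I, -1 - Complex.I; 1 - Complex.I, 1 + Complex.I]

theorem cycle_mem_unitaryGroup : cycle ∈ Matrix.unitaryGroup (Fin 2) ℂ := by
  rw [Matrix.mem_unitaryGroup_iff]
  ext i j
  fin_cases i <;> fin_cases j <;> apply Complex.ext <;>
    simp [cycle, Matrix.star_apply, Matrix.mul_apply, Fin.sum_univ_two] <;> norm_num

theorem cycle_conj_sigma (k : Fin 3) : cycle * sigma k * star cycle = sigma (k + 1) := by
  fin_cases k <;> ext i j <;> fin_cases i <;> fin_cases j <;> apply Complex.ext <;>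
    simp [cycle, sigma, pauli, Matrix.star_apply, Matrix.mul_apply, Fin.sum_univ_two] <;> norm_num

/-! ### The uniform measure on pure states -/

/-- Linear isometries preserve the surface measure of the unit sphere. -/
theorem measurePreserving_toSphere {E : Type*} [NormedAddCommGroup E] [InnerProductSpace ℝ E]
    [FiniteDimensional ℝ E] [MeasurableSpace E] [BorelSpace E] (f : E ≃ₗᵢ[ℝ] E)
    (g : Metric.sphere (0 : E) 1 → Metric.sphere (0 : E) 1) (hg : ∀ x, (g x : E) = f x) :
    MeasurePreserving g (volume : Measure E).toSphere (volume : Measure E).toSphere := by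
  have hc : Continuous g := by
    refine Continuous.subtype_mk (f := fun x => (g x : E)) ?_ _
    simp only [hg]
    fun_prop
  refine ⟨hc.measurable, ?_⟩
  ext s hs
  rw [Measure.map_apply hc.measurable hs, Measure.toSphere_apply' _ (hc.measurable hs),
    Measure.toSphere_apply' _ hs]
  congr 1
  -- The surface measure of a set is a multiple of the volume of the cone over it, and isometries
  -- pull cones back to cones.
  have : Set.Ioo (0 : ℝ) 1 • (Subtype.val '' (g ⁻¹' s) : Set E) =
      f ⁻¹' (Set.Ioo (0 : ℝ) 1 • (Subtype.val '' s : Set E)) := by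
    ext x
    simp only [Set.mem_smul, Set.mem_preimage, Set.mem_image]
    constructor
    · rintro ⟨r, hr, _, ⟨y, hy, rfl⟩, rfl⟩
      exact ⟨r, hr, g y, ⟨g y, hy, rfl⟩, by rw [hg, map_smul]⟩
    · rintro ⟨r, hr, _, ⟨y, hy, rfl⟩, h⟩
      have hgy : g ⟨f.symm y, by simp⟩ = y := Subtype.ext (by rw [hg]; simp)
      refine ⟨r, hr, f.symm y, ⟨⟨f.symm y, by simp⟩, by rwa [hgy], rfl⟩, ?_⟩
      rw [← map_smul, h, f.symm_apply_apply]
  rw [this, (LinearIsometryEquiv.measurePreserving f).measure_preimage_emb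
    f.toHomeomorph.measurableEmbedding]

/-- The action of a unitary matrix on the Hilbert space of a qubit, as a real isometry. -/
def unitaryIsometry (U : Matrix.unitaryGroup (Fin 2) ℂ) :
    EuclideanSpace ℂ (Fin 2) ≃ₗᵢ[ℝ] EuclideanSpace ℂ (Fin 2) :=
  LinearIsometry.toLinearIsometryEquiv
    { toLinearMap := (Matrix.toEuclideanLin (U : Op)).restrictScalars ℝ
      norm_map' := fun v => by
        have h : star (U : Op) * (U : Op) = 1 := Unitary.coe_star_mul_self U
        have key : ∀ w : EuclideanSpace ℂ (Fin 2), ((‖w‖ ^ 2 : ℝ) : ℂ) =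
            star (w.ofLp) ⬝ᵥ w.ofLp := fun w => by
          rw [EuclideanSpace.norm_sq_eq]
          simp [Fin.sum_univ_two, dotProduct, ← Complex.normSq_eq_conj_mul_self,
            Complex.normSq_eq_norm_sq]
        have h2 : ((‖Matrix.toEuclideanLin (U : Op) v‖ ^ 2 : ℝ) : ℂ) = ((‖v‖ ^ 2 : ℝ) : ℂ) := by
          rw [key, key, Matrix.ofLp_toLpLin, Matrix.toLin'_apply, Matrix.star_mulVec,
            ← Matrix.dotProduct_mulVec, Matrix.mulVec_mulVec, ← Matrix.star_eq_conjTranspose, h,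
            Matrix.one_mulVec]
        have h3 := Complex.ofReal_injective h2
        exact (sq_eq_sq₀ (norm_nonneg _) (norm_nonneg _)).1 h3 }
    rfl

/-- The uniform probability measure on pure states. -/
def uniformMeasure : Measure (Metric.sphere (0 : EuclideanSpace ℂ (Fin 2)) 1) :=
  ((volume : Measure (EuclideanSpace ℂ (Fin 2))).toSphere Set.univ)⁻¹ •
    (volume : Measure (EuclideanSpace ℂ (Fin 2))).toSphere

instance : IsProbabilityMeasure uniformMeasure := by
  have : NeZero (volume : Measure (EuclideanSpace ℂ (Fin 2))).toSphere :=
    ⟨Measure.toSphere_ne_zero _⟩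
  unfold uniformMeasure
  infer_instance

theorem continuous_pureState : Continuous pureState := by
  refine continuous_matrix fun i j => ?_
  simp only [pureState, Matrix.vecMulVec_apply, Pi.star_apply]
  fun_prop

theorem integral_pureState_conj (U : Matrix.unitaryGroup (Fin 2) ℂ) {φ : Op → ℝ}
    (hφ : Continuous φ) :
    ∫ ψ, φ ((U : Op) * pureState ψ * star (U : Op)) ∂uniformMeasure =
      ∫ ψ, φ (pureState ψ) ∂uniformMeasure := by
  let g : Metric.sphere (0 : EuclideanSpace ℂ (Fin 2)) 1 →
      Metric.sphere (0 : EuclideanSpace ℂ (Fin 2)) 1 := fun x => ⟨unitaryIsometry U x, by simp⟩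
  have hg : MeasurePreserving g uniformMeasure uniformMeasure :=
    (measurePreserving_toSphere (unitaryIsometry U) g fun _ => rfl).smul_measure _
  have hpure : ∀ ψ, (U : Op) * pureState ψ * star (U : Op) = pureState (g ψ) := by
    intro ψ
    change _ = Matrix.vecMulVec ((U : Op).mulVec _) (star ((U : Op).mulVec _))
    rw [Matrix.star_mulVec, ← Matrix.vecMulVec_mul, ← Matrix.mul_vecMulVec]
    rfl
  simp_rw [hpure]
  have hm : AEStronglyMeasurable (fun ψ => φ (pureState ψ)) (uniformMeasure.map g) :=
    (hφ.comp continuous_pureState).aestronglyMeasurable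
  rw [← integral_map hg.measurable.aemeasurable hm, hg.map_eq]

theorem isHermitian_pureState (ψ) : (pureState ψ).IsHermitian := by
  ext i j
  simp [pureState, Matrix.vecMulVec_apply, mul_comm]

theorem trace_pureState (ψ) : (pureState ψ).trace = 1 := by
  have h : ‖(ψ : EuclideanSpace ℂ (Fin 2))‖ ^ 2 = 1 := by simp
  rw [EuclideanSpace.norm_sq_eq, Fin.sum_univ_two] at h
  simp only [pureState, Matrix.trace_fin_two, Matrix.vecMulVec_apply, Pi.star_apply]
  simp only [RCLike.star_def, Complex.mul_conj, Complex.normSq_eq_norm_sq]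
  exact_mod_cast h

theorem sum_coord_pureState_sq (ψ) : ∑ k, coord k (pureState ψ) ^ 2 = 1 := by
  have h := congrArg Complex.re (trace_pureState ψ)
  simp [pureState] at h
  simp [Fin.sum_univ_three, coord_zero, coord_one, coord_two, pureState, Matrix.vecMulVec_apply]
  have h2 := congrArg (fun t => t ^ 2) h
  linear_combination h2

theorem continuous_coord (k : Fin 3) : Continuous (coord k) := by
  unfold coord
  exact Complex.continuous_re.comp (Continuous.matrix_trace (continuous_const.mul continuous_id))

theorem integrable_of_continuous
    {f : Metric.sphere (0 : EuclideanSpace ℂ (Fin 2)) 1 → ℝ} (hf : Continuous f) :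
    Integrable f uniformMeasure :=
  hf.integrable_of_hasCompactSupport (HasCompactSupport.of_compactSpace f)

theorem coord_star_conj (U A : Op) (k : Fin 3) :
    coord k (star U * A * U) = ((U * sigma k * star U) * A).trace.re := by
  rw [coord, Matrix.trace_mul_comm, Matrix.mul_assoc, Matrix.trace_mul_comm, Matrix.mul_assoc,
    Matrix.mul_assoc, Matrix.mul_assoc, ← Matrix.trace_mul_comm]

/-- Conjugation by a Pauli matrix preserves the measure; each coordinate is flipped by conjugation
with `X` or with `Y`. -/
theorem integral_coord_pureState (k : Fin 3) :
    ∫ ψ, coord k (pureState ψ) ∂uniformMeasure = 0 := by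
  have key : ∀ a : Fin 4, ∫ ψ, coord k (pureState ψ) ∂uniformMeasure =
      pauliSign a k * ∫ ψ, coord k (pureState ψ) ∂uniformMeasure := fun a => by
    rw [← integral_const_mul,
      ← integral_pureState_conj (star ⟨pauli a, pauli_mem_unitaryGroup a⟩) (continuous_coord k)]
    congr 1
    ext ψ
    simp only [Unitary.coe_star, star_star]
    rw [coord_star_conj, pauli_conj_sigma]
    simp [coord]
  have h1 := key 1
  have h2 := key 2
  fin_cases k <;> simp [pauliSign] at h1 h2 ⊢ <;> linarith

/-- The three-cycle makes the three second moments equal, and they add up to `1` because pure states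
have unit Bloch vectors. -/
theorem integral_coord_pureState_sq (k : Fin 3) :
    ∫ ψ, coord k (pureState ψ) ^ 2 ∂uniformMeasure = 1 / 3 := by
  have key : ∀ k : Fin 3, ∫ ψ, coord k (pureState ψ) ^ 2 ∂uniformMeasure =
      ∫ ψ, coord (k + 1) (pureState ψ) ^ 2 ∂uniformMeasure := fun k => by
    rw [← integral_pureState_conj (star ⟨cycle, cycle_mem_unitaryGroup⟩)
      (φ := fun A => coord k A ^ 2) ((continuous_coord k).pow 2)]
    congr 1
    ext ψ
    simp only [Unitary.coe_star, star_star]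
    rw [coord_star_conj, cycle_conj_sigma, coord]
  have hsum : ∑ k, ∫ ψ, coord k (pureState ψ) ^ 2 ∂uniformMeasure = 1 := by
    have hint : ∀ k, Integrable (fun ψ => coord k (pureState ψ) ^ 2) uniformMeasure := fun k =>
      integrable_of_continuous (((continuous_coord k).comp continuous_pureState).pow 2)
    rw [← integral_finsetSum _ fun k _ => hint k]
    simp [sum_coord_pureState_sq]
  have h0 := key 0
  have h1 := key 1
  simp only [Fin.sum_univ_three] at hsum
  have e1 : (0 : Fin 3) + 1 = 1 := rfl
  have e2 : (1 : Fin 3) + 1 = 2 := rfl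
  rw [e1] at h0
  rw [e2] at h1
  fin_cases k <;> simp <;> linarith

/-- The infidelity of a channel acting affinely and diagonally on Bloch vectors. -/
theorem infidelity_eq {Λ : SuperOp} {d α : Fin 3 → ℝ}
    (h : ∀ x, Λ (bloch x) = bloch fun k => d k * x k + α k) :
    infidelity Λ = (3 - ∑ k, d k) / 6 := by
  have hF : avgFidelity Λ = ∫ ψ, (1 + ∑ k, (d k * coord k (pureState ψ) ^ 2 +
      α k * coord k (pureState ψ))) / 2 ∂uniformMeasure := by
    unfold avgFidelity average
    congr 1
    ext ψ
    have hb := eq_bloch_of_isHermitian (isHermitian_pureState ψ) (trace_pureState ψ)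
    have hx : ∀ (A : Op) (x : Fin 3 → ℝ), A = bloch x →
        (A * Λ A).trace.re = (1 + ∑ k, (d k * x k ^ 2 + α k * x k)) / 2 := by
      rintro _ x rfl
      rw [h, trace_bloch_mul_bloch]
      congr 2
      exact Finset.sum_congr rfl fun k _ => by ring
    exact hx _ _ hb
  have h1 : ∀ k, Integrable (fun ψ => d k * coord k (pureState ψ) ^ 2) uniformMeasure := fun k =>
    integrable_of_continuous ((((continuous_coord k).comp continuous_pureState).pow 2).const_mul _)
  have h2 : ∀ k, Integrable (fun ψ => α k * coord k (pureState ψ)) uniformMeasure := fun k =>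
    integrable_of_continuous (((continuous_coord k).comp continuous_pureState).const_mul _)
  have h3 : ∀ k, Integrable (fun ψ => d k * coord k (pureState ψ) ^ 2 +
      α k * coord k (pureState ψ)) uniformMeasure := fun k => (h1 k).add (h2 k)
  rw [infidelity, hF, integral_div, integral_add (integrable_const _)
    (integrable_finsetSum _ fun k _ => h3 k), integral_finsetSum _ fun k _ => h3 k]
  simp only [integral_add (h1 _) (h2 _), integral_const_mul, integral_coord_pureState,
    integral_coord_pureState_sq]
  simp [Fin.sum_univ_three]
  ring

/-! ### Clifford gates as signed permutations -/

theorem pauliGroup_le_normalizer :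
    pauliGroup ≤ Subgroup.normalizer (pauliGroup : Set (Matrix.unitaryGroup (Fin 2) ℂ)) :=
  Subgroup.le_normalizer

/-- Conjugation by a Pauli matrix as a Clifford gate. -/
def pauliGate (a : Fin 4) : cliffordGroup :=
  ⟨Unitary.conjStarAlgAut ℂ Op ⟨pauli a, pauli_mem_unitaryGroup a⟩,
    Subgroup.mem_map_of_mem _ (pauliGroup_le_normalizer (Subgroup.subset_closure ⟨a, rfl⟩))⟩

theorem cycle_mem_normalizer : (⟨cycle, cycle_mem_unitaryGroup⟩ : Matrix.unitaryGroup (Fin 2) ℂ) ∈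
    Subgroup.normalizer (pauliGroup : Set (Matrix.unitaryGroup (Fin 2) ℂ)) := by
  set c : Matrix.unitaryGroup (Fin 2) ℂ := ⟨cycle, cycle_mem_unitaryGroup⟩ with hc
  have hcc : cycle * star cycle = 1 := (Matrix.mem_unitaryGroup_iff).1 cycle_mem_unitaryGroup
  have key : ∀ j : Fin 4, ∃ l, cycle * pauli j * star cycle = pauli l := by
    intro j
    refine Fin.cases ⟨0, ?_⟩ (fun k => ⟨_, cycle_conj_sigma k⟩) j
    simpa [pauli] using hcc
  have key' : ∀ j : Fin 4, ∃ l, cycle * pauli l * star cycle = pauli j := by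
    intro j
    refine Fin.cases ⟨0, ?_⟩ (fun k => ⟨(k - 1).succ, ?_⟩) j
    · simpa [pauli] using hcc
    · simpa [sigma] using cycle_conj_sigma (k - 1)
  have himage : (MulAut.conj c).toMonoidHom '' {U | ∃ j, (U : Op) = pauli j} =
      {U : Matrix.unitaryGroup (Fin 2) ℂ | ∃ j, (U : Op) = pauli j} := by
    ext U
    constructor
    · rintro ⟨V, ⟨j, hj⟩, rfl⟩
      obtain ⟨l, hl⟩ := key j
      exact ⟨l, by rw [← hl, ← hj]; rfl⟩
    · rintro ⟨j, hj⟩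
      obtain ⟨l, hl⟩ := key' j
      refine ⟨⟨pauli l, pauli_mem_unitaryGroup l⟩, ⟨l, rfl⟩, Subtype.ext ?_⟩
      rw [hj, ← hl]; rfl
  -- Conjugation maps the generating set onto itself, not merely into it; equality of the images is
  -- what gives both directions of the normalizer condition.
  have hmap : pauliGroup.map (MulAut.conj c).toMonoidHom = pauliGroup := by
    rw [pauliGroup, MonoidHom.map_closure, himage]
  rw [Subgroup.mem_normalizer_iff]
  intro h
  constructor
  · intro hh
    have := Subgroup.mem_map_of_mem (MulAut.conj c).toMonoidHom hh
    rw [hmap] at this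
    exact this
  · intro hh
    change c * h * c⁻¹ ∈ pauliGroup at hh
    rw [← hmap] at hh
    obtain ⟨h', hh', he⟩ := hh
    have : h' = h := (MulAut.conj c).injective he
    exact this ▸ hh'

/-- The three-cycle `X ↦ Y ↦ Z ↦ X` as a Clifford gate. -/
def cycleGate : cliffordGroup :=
  ⟨Unitary.conjStarAlgAut ℂ Op ⟨cycle, cycle_mem_unitaryGroup⟩,
    Subgroup.mem_map_of_mem _ cycle_mem_normalizer⟩

theorem gate_one : gate 1 = 1 := rfl

theorem gate_mul (g h : cliffordGroup) : gate (g * h) = gate g * gate h := rfl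

theorem gate_apply_one (g : cliffordGroup) : gate g 1 = 1 := map_one (g : Op ≃⋆ₐ[ℂ] Op)

theorem gate_pauliGate_sigma (a : Fin 4) (k : Fin 3) :
    gate (pauliGate a) (sigma k) = (pauliSign a k : ℂ) • sigma k :=
  pauli_conj_sigma a k

theorem gate_cycleGate_sigma (k : Fin 3) : gate cycleGate (sigma k) = sigma (k + 1) :=
  cycle_conj_sigma k

theorem sigma_smul_inj {c c' : ℂ} {k l : Fin 3} (hc : c ≠ 0) (h : c • sigma k = c' • sigma l) :
    k = l ∧ c = c' := by
  have h00 := congrFun (congrFun h 0) 0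
  have h01 := congrFun (congrFun h 0) 1
  have h10 := congrFun (congrFun h 1) 0
  have hI := Complex.I_ne_zero
  fin_cases k <;> fin_cases l <;> simp [sigma, pauli, hc] at h00 h01 h10 ⊢ <;>
    first
    | assumption
    | exact hc h00
    | (apply hc; linear_combination h01 / 2 + h10 / 2)
    | (apply hc; linear_combination (Complex.I / 2) * (h01 - h10) + c * Complex.I_sq)

/-- The image lies in the Pauli group, so it is a power of `I` times a Pauli matrix. It is
traceless, which excludes the identity, and Hermitian, which excludes odd powers of `I`. -/
theorem gate_sigma (g : cliffordGroup) (k : Fin 3) :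
    ∃ (ε : ℝ) (l : Fin 3), ε ^ 2 = 1 ∧ gate g (sigma k) = (ε : ℂ) • sigma l := by
  obtain ⟨g, U, hU, rfl⟩ := g
  have h1 : (⟨sigma k, pauli_mem_unitaryGroup _⟩ : Matrix.unitaryGroup (Fin 2) ℂ) ∈ pauliGroup :=
    Subgroup.subset_closure ⟨k.succ, rfl⟩
  obtain ⟨n, l, h⟩ := pauliGroup_coe_mem _ ((hU _).1 h1)
  have h : (U : Op) * sigma k * star (U : Op) = Complex.I ^ (n : ℕ) • pauli l := h
  have hUU : star (U : Op) * (U : Op) = 1 := Unitary.coe_star_mul_self U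
  have htr : ((U : Op) * sigma k * star (U : Op)).trace = 0 := by
    rw [Matrix.trace_mul_comm, ← Matrix.mul_assoc, hUU, Matrix.one_mul]
    fin_cases k <;> simp [sigma, pauli, Matrix.trace_fin_two]
  have hstar : star ((U : Op) * sigma k * star (U : Op)) = (U : Op) * sigma k * star (U : Op) := by
    have : star (sigma k) = sigma k := by
      fin_cases k <;> ext a b <;> fin_cases a <;> fin_cases b <;>
        simp [sigma, pauli, Matrix.star_apply]
    simp only [star_mul, star_star, this, Matrix.mul_assoc]
  rw [h] at htr hstar
  have hreal : ∀ l : Fin 3, star (Complex.I ^ (n : ℕ) • pauli l.succ) =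
      Complex.I ^ (n : ℕ) • pauli l.succ → ∃ ε : ℝ, ε ^ 2 = 1 ∧ (ε : ℂ) = Complex.I ^ (n : ℕ) := by
    intro l hl
    have h00 := congrFun (congrFun hl 0) 0
    have h01 := congrFun (congrFun hl 0) 1
    fin_cases n
    · exact ⟨1, by norm_num, by simp⟩
    · exfalso
      fin_cases l <;> simp [pauli, Matrix.star_apply, Complex.ext_iff] at h00 h01 <;> linarith
    · exact ⟨-1, by norm_num, by simp⟩
    · exfalso
      fin_cases l <;>
        simp [pauli, Matrix.star_apply, Complex.ext_iff, Complex.I_pow_three] at h00 h01 <;>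
        linarith
  induction l using Fin.cases with
  | zero =>
    exfalso
    simp [pauli] at htr
  | succ l =>
    obtain ⟨ε, hε, hε'⟩ := hreal l hstar
    refine ⟨ε, l, hε, ?_⟩
    rw [hε']
    exact h

/-- The sign with which a Clifford gate permutes the Pauli matrices. -/
def gateSign (g : cliffordGroup) (k : Fin 3) : ℝ := (gate_sigma g k).choose

/-- The permutation of the Pauli matrices induced by a Clifford gate. -/
def gateIndex (g : cliffordGroup) (k : Fin 3) : Fin 3 := (gate_sigma g k).choose_spec.choose

theorem gateSign_sq (g : cliffordGroup) (k : Fin 3) : gateSign g k ^ 2 = 1 :=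
  (gate_sigma g k).choose_spec.choose_spec.1

theorem gateSign_ne_zero (g : cliffordGroup) (k : Fin 3) : (gateSign g k : ℂ) ≠ 0 := by
  intro h
  have := gateSign_sq g k
  rw [Complex.ofReal_eq_zero.1 h] at this
  norm_num at this

theorem gate_apply_sigma (g : cliffordGroup) (k : Fin 3) :
    gate g (sigma k) = (gateSign g k : ℂ) • sigma (gateIndex g k) :=
  (gate_sigma g k).choose_spec.choose_spec.2

theorem gateIndex_injective (g : cliffordGroup) : Function.Injective (gateIndex g) := by
  intro k l hkl
  have hk := gate_apply_sigma g k
  have hl := gate_apply_sigma g l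
  rw [hkl] at hk
  -- If two Pauli matrices had proportional images, suitable multiples of them would have equal
  -- images, against injectivity of the gate.
  have h : gate g ((gateSign g l : ℂ) • sigma k) = gate g ((gateSign g k : ℂ) • sigma l) := by
    rw [map_smul, map_smul, hk, hl, smul_comm]
  exact (sigma_smul_inj (gateSign_ne_zero g l) ((g : Op ≃⋆ₐ[ℂ] Op).injective h)).1

theorem gateIndex_bijective (g : cliffordGroup) : Function.Bijective (gateIndex g) :=
  Finite.injective_iff_bijective.1 (gateIndex_injective g)

theorem gate_eq_of {g : cliffordGroup} {k l : Fin 3} {ε : ℝ}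
    (h : gate g (sigma k) = (ε : ℂ) • sigma l) : gateIndex g k = l ∧ gateSign g k = ε := by
  rw [gate_apply_sigma] at h
  obtain ⟨h1, h2⟩ := sigma_smul_inj (gateSign_ne_zero g k) h
  exact ⟨h1, Complex.ofReal_injective h2⟩

theorem gate_pauliGate_mul (a : Fin 4) (g : cliffordGroup) (k : Fin 3) :
    gateIndex (pauliGate a * g) k = gateIndex g k ∧
      gateSign (pauliGate a * g) k = gateSign g k * pauliSign a (gateIndex g k) := by
  apply gate_eq_of
  rw [gate_mul, Module.End.mul_apply, gate_apply_sigma, map_smul, gate_pauliGate_sigma, smul_smul]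
  push_cast
  rfl

theorem gate_cycleGate_mul (g : cliffordGroup) (k : Fin 3) :
    gateIndex (cycleGate * g) k = gateIndex g k + 1 ∧
      gateSign (cycleGate * g) k = gateSign g k := by
  apply gate_eq_of
  rw [gate_mul, Module.End.mul_apply, gate_apply_sigma, map_smul, gate_cycleGate_sigma]

/-! ### Averages over the Clifford group -/

theorem expect_mul_left (k : cliffordGroup) (φ : cliffordGroup → ℝ) :
    (Finset.univ.expect fun g => φ (k * g)) = Finset.univ.expect φ :=
  Fintype.expect_equiv (Equiv.mulLeft k) _ _ fun _ => rfl

/-- A function of the induced permutation whose cyclic averages are constant has that average. -/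
theorem expect_of_cyclic {f : (Fin 3 → Fin 3) → ℝ} {c : ℝ}
    (h : ∀ π, Function.Injective π →
      f π + f (fun k => π k + 1) + f (fun k => π k + 2) = 3 * c) :
    (Finset.univ.expect fun g => f (gateIndex g)) = c := by
  have h1 := expect_mul_left cycleGate fun g => f (gateIndex g)
  have h2 := expect_mul_left (cycleGate * cycleGate) fun g => f (gateIndex g)
  have e1 : ∀ g, gateIndex (cycleGate * g) = fun k => gateIndex g k + 1 := fun g =>
    funext fun k => (gate_cycleGate_mul g k).1
  have e2 : ∀ g, gateIndex (cycleGate * cycleGate * g) = fun k => gateIndex g k + 2 := fun g => by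
    funext k
    rw [mul_assoc, e1, e1]
    change gateIndex g k + 1 + 1 = _
    rw [add_assoc]
    rfl
  simp only [e1, e2] at h1 h2
  have h3 : (Finset.univ.expect fun g : cliffordGroup => f (gateIndex g) +
      f (fun k => gateIndex g k + 1) + f (fun k => gateIndex g k + 2)) = 3 * c := by
    simp only [h _ (gateIndex_injective _), Fintype.expect_const]
  rw [Finset.expect_add_distrib, Finset.expect_add_distrib, h1, h2] at h3
  linarith

/-- By translation invariance, averaging over the group may be preceded by averaging over each coset
of the Pauli gates. -/
theorem expect_of_pauli {φ : cliffordGroup → ℝ}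
    (h : ∀ g, ∑ a, φ (pauliGate a * g) = 0) : Finset.univ.expect φ = 0 := by
  have h3 : (Finset.univ.expect fun g : cliffordGroup => ∑ a, φ (pauliGate a * g)) = 0 := by
    simp [h]
  rw [Finset.expect_sum_comm] at h3
  simp only [expect_mul_left, Finset.sum_const] at h3
  simpa using h3

/-- Pauli gates leave the permutation alone and change the sign by a nontrivial character, whose sum
over the four Pauli matrices vanishes. For two distinct indices the analogue below rests on
orthogonality of characters. -/
theorem expect_gateSign_mul (f : (Fin 3 → Fin 3) → ℝ) (i : Fin 3) :
    (Finset.univ.expect fun g => gateSign g i * f (gateIndex g)) = 0 := by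
  refine expect_of_pauli fun g => ?_
  have e1 : ∀ a, gateIndex (pauliGate a * g) = gateIndex g := fun a =>
    funext fun k => (gate_pauliGate_mul a g k).1
  simp only [e1, (gate_pauliGate_mul _ g i).2, mul_assoc]
  rw [← Finset.mul_sum, ← Finset.sum_mul]
  have : ∀ l, ∑ a, pauliSign a l = 0 := fun l => by
    fin_cases l <;> simp [pauliSign, Fin.sum_univ_four]
  rw [this]
  ring

theorem expect_gateSign_mul_gateSign_mul (f : (Fin 3 → Fin 3) → ℝ) {i j : Fin 3} (hij : i ≠ j) :
    (Finset.univ.expect fun g => gateSign g i * gateSign g j * f (gateIndex g)) = 0 := by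
  refine expect_of_pauli fun g => ?_
  have e1 : ∀ a, gateIndex (pauliGate a * g) = gateIndex g := fun a =>
    funext fun k => (gate_pauliGate_mul a g k).1
  simp only [e1, (gate_pauliGate_mul _ g _).2]
  have : ∀ l l', l ≠ l' → ∑ a, pauliSign a l * pauliSign a l' = 0 := fun l l' h => by
    fin_cases l <;> fin_cases l' <;> simp [pauliSign, Fin.sum_univ_four] at h ⊢
  have h2 := this _ _ ((gateIndex_injective g).ne hij)
  calc _ = gateSign g i * gateSign g j * f (gateIndex g) *
        ∑ a, pauliSign a (gateIndex g i) * pauliSign a (gateIndex g j) := by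
        rw [Finset.mul_sum]
        exact Finset.sum_congr rfl fun a _ => by ring
    _ = 0 := by rw [h2, mul_zero]

/-! ### Channels with a diagonal unital block -/

theorem eq_sum_pauli (A : Op) :
    A = (A.trace / 2) • (1 : Op) + ∑ k, ((sigma k * A).trace / 2) • sigma k := by
  ext i j
  fin_cases i <;> fin_cases j <;>
    simp [Fin.sum_univ_three, sigma_zero, sigma_one, sigma_two, Matrix.trace_fin_two,
      Matrix.vecMul, dotProduct, Fin.sum_univ_two] <;> ring_nf <;> simp <;> ring

theorem trace_sigma (k : Fin 3) : (sigma k).trace = 0 := by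
  fin_cases k <;> simp [sigma, pauli, Matrix.trace_fin_two]

theorem liouville_succ (Λ : SuperOp) (j k : Fin 3) :
    unitalBlock Λ j k = (sigma j * Λ (sigma k)).trace / 2 := by
  have hstar : (pauli j.succ).conjTranspose = pauli j.succ := by
    fin_cases j <;> ext a b <;> fin_cases a <;> fin_cases b <;> simp [pauli]
  have h2 : ((Real.sqrt 2 : ℝ) : ℂ)⁻¹ * ((Real.sqrt 2 : ℝ) : ℂ)⁻¹ = 2⁻¹ := by
    rw [← mul_inv, ← Complex.ofReal_mul, Real.mul_self_sqrt (by norm_num)]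
    norm_num
  simp only [unitalBlock, liouville, pauliBasis, Matrix.submatrix_apply, Matrix.of_apply,
    Matrix.conjTranspose_smul, hstar, map_smul, Matrix.smul_mul, Matrix.mul_smul, smul_smul,
    Matrix.trace_smul, smul_eq_mul]
  simp only [RCLike.star_def, map_inv₀, Complex.conj_ofReal]
  rw [h2, div_eq_inv_mul]
  rfl

theorem apply_sigma_of_isDiag {Λ : SuperOp} (hΛ : IsCPTP Λ) (hd : (unitalBlock Λ).IsDiag)
    (k : Fin 3) : Λ (sigma k) = ((sigma k * Λ (sigma k)).trace / 2) • sigma k := by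
  conv_lhs => rw [eq_sum_pauli (Λ (sigma k))]
  rw [hΛ.trace_map, trace_sigma, Finset.sum_eq_single k]
  · simp
  · intro j _ hj
    have : unitalBlock Λ j k = 0 := hd hj
    rw [liouville_succ] at this
    rw [this, zero_smul]
  · simp

/-- The Choi matrix of a completely positive map is positive semidefinite. -/
theorem posSemidef_choi {Λ : SuperOp} (hΛ : IsCPTP Λ) :
    (Matrix.of fun p q : Fin 2 × Fin 2 => Λ (Matrix.single p.1 q.1 1) p.2 q.2).PosSemidef := by
  -- The unnormalized maximally entangled vector: the blocks of its projector are the matrix units.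
  let ω : Fin 2 × Fin 2 → ℂ := fun p => if p.1 = p.2 then 1 else 0
  have h := hΛ.completelyPositive 2 _ (Matrix.posSemidef_vecMulVec_self_star ω)
  have hE : ∀ i j : Fin 2, (Matrix.of fun a b => Matrix.vecMulVec ω (star ω) (i, a) (j, b)) =
      Matrix.single i j (1 : ℂ) := by
    intro i j
    ext a b
    by_cases hi : i = a <;> by_cases hj : j = b <;>
      simp [ω, Matrix.vecMulVec_apply, hi, hj]
  simpa only [ampliation, hE] using h

theorem choi_nonneg {Λ : SuperOp} (hΛ : IsCPTP Λ) (M : Op) :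
    0 ≤ ∑ i, ∑ a, star (M i a) * ∑ j, ∑ b, Λ (Matrix.single i j 1) a b * M j b := by
  simpa only [dotProduct, Matrix.mulVec, Matrix.of_apply, Fintype.sum_prod_type,
    Pi.star_apply] using (posSemidef_choi hΛ).dotProduct_mulVec_nonneg fun p => M p.1 p.2

theorem choi_conj {Λ : SuperOp} (hΛ : IsCPTP Λ) (i j a b : Fin 2) :
    star (Λ (Matrix.single j i 1) b a) = Λ (Matrix.single i j 1) a b :=
  (posSemidef_choi hΛ).isHermitian.apply (i, a) (j, b)

/-- A map acting on the Pauli matrices by `1 ↦ 1 + α · σ` and `σ_k ↦ d_k σ_k`. -/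
structure IsDiagonal (Λ : SuperOp) (d α : Fin 3 → ℝ) : Prop where
  map_one : Λ 1 = 1 + ∑ k, (α k : ℂ) • sigma k
  map_sigma : ∀ k, Λ (sigma k) = (d k : ℂ) • sigma k

theorem IsDiagonal.apply_bloch {Λ : SuperOp} {d α : Fin 3 → ℝ} (h : IsDiagonal Λ d α)
    (x : Fin 3 → ℝ) : Λ (bloch x) = bloch fun k => d k * x k + α k := by
  simp only [bloch, map_smul, map_add, map_sum, h.map_one, h.map_sigma, smul_smul]
  congr 1
  rw [add_assoc, ← Finset.sum_add_distrib]
  congr 1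
  refine Finset.sum_congr rfl fun k _ => ?_
  rw [← add_smul]
  push_cast
  ring_nf

theorem single_eq (Λ : SuperOp) :
    Λ (Matrix.single 0 0 1) = (1 / 2 : ℂ) • (Λ 1 + Λ (sigma 2)) ∧
    Λ (Matrix.single 0 1 1) = (1 / 2 : ℂ) • (Λ (sigma 0) + Complex.I • Λ (sigma 1)) ∧
    Λ (Matrix.single 1 0 1) = (1 / 2 : ℂ) • (Λ (sigma 0) - Complex.I • Λ (sigma 1)) ∧
    Λ (Matrix.single 1 1 1) = (1 / 2 : ℂ) • (Λ 1 - Λ (sigma 2)) := by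
  simp only [← map_smul, ← map_add, ← map_sub]
  refine ⟨congrArg Λ ?_, congrArg Λ ?_, congrArg Λ ?_, congrArg Λ ?_⟩ <;> ext i j <;>
    fin_cases i <;> fin_cases j <;>
    simp [sigma_zero, sigma_one, sigma_two] <;> norm_num

/-- Trace preservation and the diagonal block give this form with complex coefficients; the Choi
matrix being Hermitian makes them real. -/
theorem exists_isDiagonal {Λ : SuperOp} (hΛ : IsCPTP Λ) (hd : (unitalBlock Λ).IsDiag) :
    ∃ d α : Fin 3 → ℝ, IsDiagonal Λ d α := by
  have h1 : Λ 1 = 1 + ∑ k, ((sigma k * Λ 1).trace / 2) • sigma k := by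
    conv_lhs => rw [eq_sum_pauli (Λ 1)]
    rw [hΛ.trace_map]
    simp
  have hs := apply_sigma_of_isDiag hΛ hd
  obtain ⟨d, hs⟩ : ∃ d : Fin 3 → ℂ, ∀ k, Λ (sigma k) = d k • sigma k := ⟨_, hs⟩
  obtain ⟨α, h1⟩ : ∃ α : Fin 3 → ℂ, Λ 1 = 1 + ∑ k, α k • sigma k := ⟨_, h1⟩
  obtain ⟨e00, e01, e10, e11⟩ := single_eq Λ
  rw [h1, hs] at e00 e11
  rw [hs, hs] at e01 e10
  have c1 := congrArg Complex.im (choi_conj hΛ 0 0 0 0)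
  have c2 := congrArg Complex.im (choi_conj hΛ 1 1 0 0)
  have c3 := congrArg Complex.im (choi_conj hΛ 0 0 0 1)
  have c4 := congrArg Complex.re (choi_conj hΛ 0 0 0 1)
  have c5 := congrArg Complex.im (choi_conj hΛ 0 1 0 1)
  have c6 := congrArg Complex.im (choi_conj hΛ 0 1 1 0)
  simp only [e00, e01, e10, e11] at c1 c2 c3 c4 c5 c6
  simp [Fin.sum_univ_three, sigma_zero, sigma_one, sigma_two] at c1 c2 c3 c4 c5 c6
  have hα : ∀ k, ((α k).re : ℂ) = α k := fun k => by
    apply Complex.ext <;> fin_cases k <;> simp <;> linarith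
  have hd : ∀ k, ((d k).re : ℂ) = d k := fun k => by
    apply Complex.ext <;> fin_cases k <;> simp <;> linarith
  exact ⟨fun k => (d k).re, fun k => (α k).re, by simp only [hα]; exact h1,
    fun k => by rw [hd]; exact hs k⟩

theorem IsDiagonal.constraints {Λ : SuperOp} {d α : Fin 3 → ℝ} (h : IsDiagonal Λ d α)
    (hΛ : IsCPTP Λ) :
    (0 ≤ 1 + d 0 + d 1 + d 2 ∧ 0 ≤ 1 + d 0 - d 1 - d 2 ∧ 0 ≤ 1 - d 0 + d 1 - d 2 ∧
      0 ≤ 1 - d 0 - d 1 + d 2) ∧ ∀ k, |α k| ≤ 1 - d k := by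
  obtain ⟨e00, e01, e10, e11⟩ := single_eq Λ
  rw [h.map_one, h.map_sigma] at e00 e11
  rw [h.map_sigma, h.map_sigma] at e01 e10
  have key : ∀ M : Op, _ := fun M => (Complex.le_def.1 (choi_nonneg hΛ M)).1
  simp only [Fin.sum_univ_two, Fin.sum_univ_three, e00, e01, e10, e11, sigma_zero, sigma_one,
    sigma_two] at key
  -- The four Bell vectors give the inequalities on `d` alone. The six product vectors after them
  -- pair a Pauli eigenstate as input with the orthogonal eigenstate as output, and give `1 - d k ±
  -- α k ≥ 0`.
  have b1 := key !![1, 0; 0, 1]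
  have b2 := key !![1, 0; 0, -1]
  have b3 := key !![0, 1; 1, 0]
  have b4 := key !![0, 1; -1, 0]
  have x1 := key !![1, -1; 1, -1]
  have x2 := key !![1, 1; -1, -1]
  have y1 := key !![1, -Complex.I; -Complex.I, -1]
  have y2 := key !![1, Complex.I; Complex.I, -1]
  have z1 := key !![0, 1; 0, 0]
  have z2 := key !![0, 0; 1, 0]
  simp at b1 b2 b3 b4 x1 x2 y1 y2 z1 z2
  refine ⟨⟨by linarith, by linarith, by linarith, by linarith⟩, fun k => abs_le.2 ?_⟩
  fin_cases k <;> constructor <;> simp <;> linarith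

/-! ### Reduction of a sequence to independent twirls -/

/-- The sequence `(g_m Λ) ⋯ (g_1 Λ) g_0` without the initial noise. -/
def alignedOp (Λ : SuperOp) {m : ℕ} (s : Fin m → cliffordGroup) : SuperOp :=
  (List.ofFn fun t => gate (s t) * Λ).reverse.prod * gate (List.ofFn s).reverse.prod⁻¹

theorem sequenceOp_constNoise (Λ₀ Λ : SuperOp) {m : ℕ} (s : Fin m → cliffordGroup) :
    sequenceOp (constNoise m Λ₀ Λ) s = alignedOp Λ s * Λ₀ := by
  simp [sequenceOp, constNoise, gates, alignedOp, List.ofFn_succ, mul_assoc]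

/-- With `P` the product of the later gates, inserting `P⁻¹ P` before `g` restores the correcting
gate of the shorter sequence and leaves the first noise conjugated by `P g`. -/
theorem alignedOp_cons (Λ : SuperOp) {m : ℕ} (s : Fin m → cliffordGroup) (g : cliffordGroup) :
    alignedOp Λ (Fin.cons g s : Fin (m + 1) → cliffordGroup) =
      alignedOp Λ s * (gate ((List.ofFn s).reverse.prod * g) * Λ *
        gate ((List.ofFn s).reverse.prod * g)⁻¹) := by
  have h : gate (List.ofFn s).reverse.prod⁻¹ * gate ((List.ofFn s).reverse.prod * g) = gate g := by
    rw [← gate_mul, inv_mul_cancel_left]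
  simp only [alignedOp, List.ofFn_succ, Fin.cons_zero, Fin.cons_succ, List.reverse_cons,
    List.prod_append, List.prod_singleton]
  rw [mul_assoc _ (gate _) (_ * _), ← mul_assoc (gate _) (_ * _), ← mul_assoc (gate _) (gate _),
    h]
  simp only [mul_assoc]

theorem expect_cons {m : ℕ} (f : (Fin (m + 1) → cliffordGroup) → ℝ) :
    Finset.univ.expect f = Finset.univ.expect fun s : Fin m → cliffordGroup =>
      Finset.univ.expect fun g => f (Fin.cons g s) := by
  rw [← Fintype.expect_equiv (Fin.consEquiv fun _ : Fin (m + 1) => cliffordGroup)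
    (fun p => f (Fin.cons p.1 p.2)) f fun _ => rfl, ← Finset.univ_product_univ,
    Finset.expect_product, Finset.expect_comm]

theorem expect_alignedOp_succ (Λ : SuperOp) (m : ℕ) (φ : SuperOp → ℝ) :
    (Finset.univ.expect fun s : Fin (m + 1) → cliffordGroup => φ (alignedOp Λ s)) =
      Finset.univ.expect fun g : cliffordGroup =>
        Finset.univ.expect fun s : Fin m → cliffordGroup =>
          φ (alignedOp Λ s * (gate g⁻¹ * Λ * gate g)) := by
  rw [expect_cons, Finset.expect_comm (s := (Finset.univ : Finset cliffordGroup))]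
  refine Finset.expect_congr rfl fun s _ => ?_
  simp only [alignedOp_cons]
  -- For fixed later gates, `g ↦ (P g)⁻¹` is a bijection of the group, so the twirling gate is
  -- uniform and independent of them.
  refine Fintype.expect_equiv
    ((Equiv.mulLeft (List.ofFn s).reverse.prod).trans (Equiv.inv cliffordGroup)) _ _ fun g => ?_
  simp

/-! ### One twirled step in Bloch coordinates -/

/-- The Bloch vector after one step of twirled noise. -/
def stepVector (d α : Fin 3 → ℝ) (g : cliffordGroup) (x : Fin 3 → ℝ) (i : Fin 3) : ℝ :=
  d (gateIndex g i) * x i + gateSign g i * α (gateIndex g i)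

theorem gate_inv_apply (g : cliffordGroup) (A B : Op) (h : gate g A = B) : gate g⁻¹ B = A := by
  rw [← h, ← Module.End.mul_apply, ← gate_mul, inv_mul_cancel, gate_one, Module.End.one_apply]

theorem twirl_apply_bloch {Λ : SuperOp} {d α : Fin 3 → ℝ} (h : IsDiagonal Λ d α)
    (g : cliffordGroup) (x : Fin 3 → ℝ) :
    (gate g⁻¹ * Λ * gate g) (bloch x) = bloch (stepVector d α g x) := by
  rw [mul_assoc, Module.End.mul_apply]
  apply gate_inv_apply
  have hα : ∑ k, (α k : ℂ) • sigma k =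
      ∑ i, (α (gateIndex g i) : ℂ) • sigma (gateIndex g i) :=
    ((gateIndex_bijective g).sum_comp fun k => (α k : ℂ) • sigma k).symm
  simp only [bloch, Module.End.mul_apply, map_smul, map_add, map_sum, gate_apply_one,
    gate_apply_sigma, h.map_one, h.map_sigma, hα, smul_smul]
  congr 1
  rw [add_assoc, ← Finset.sum_add_distrib]
  congr 1
  refine Finset.sum_congr rfl fun i _ => ?_
  rw [← add_smul]
  have hs : (gateSign g i : ℂ) ^ 2 = 1 := by exact_mod_cast gateSign_sq g i
  congr 1
  simp only [stepVector]
  push_cast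
  linear_combination (α (gateIndex g i) : ℂ) * hs

theorem expect_stepVector (d α x : Fin 3 → ℝ) (i : Fin 3) :
    (Finset.univ.expect fun g => stepVector d α g x i) = (∑ k, d k) / 3 * x i := by
  have h1 : (Finset.univ.expect fun g => d (gateIndex g i)) = (∑ k, d k) / 3 :=
    expect_of_cyclic (f := fun π => d (π i)) fun π _ => by
      simp only [Fin.sum_univ_three]
      generalize π i = k
      fin_cases k <;> simp <;> ring
  simp only [stepVector]
  rw [Finset.expect_add_distrib, ← Finset.expect_mul, h1,
    expect_gateSign_mul (fun π => α (π i)) i, add_zero]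

/-- The cross term carries a single sign and averages out; in the square of the translation the sign
disappears, so that term survives. -/
theorem expect_stepVector_sq (d α x : Fin 3 → ℝ) (i : Fin 3) :
    (Finset.univ.expect fun g => stepVector d α g x i ^ 2) =
      (∑ k, d k ^ 2) / 3 * x i ^ 2 + (∑ k, α k ^ 2) / 3 := by
  have h1 : ∀ a : Fin 3 → ℝ,
      (Finset.univ.expect fun g => a (gateIndex g i) ^ 2) = (∑ k, a k ^ 2) / 3 := fun a =>
    expect_of_cyclic (f := fun π => a (π i) ^ 2) fun π _ => by
      simp only [Fin.sum_univ_three]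
      generalize π i = k
      fin_cases k <;> simp <;> ring
  have hexp : ∀ g, stepVector d α g x i ^ 2 = d (gateIndex g i) ^ 2 * x i ^ 2 +
      gateSign g i * (2 * x i * d (gateIndex g i) * α (gateIndex g i)) +
      α (gateIndex g i) ^ 2 := fun g => by
    simp only [stepVector]
    linear_combination α (gateIndex g i) ^ 2 * gateSign_sq g i
  simp only [hexp]
  rw [Finset.expect_add_distrib, Finset.expect_add_distrib, ← Finset.expect_mul, h1, h1,
    expect_gateSign_mul (fun π => 2 * x i * d (π i) * α (π i)) i, add_zero]

/-- Under cyclic shifts two distinct indices run through every unordered pair exactly once; every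
term containing `α` carries unpaired signs and averages to zero. -/
theorem expect_stepVector_mul (d α x : Fin 3 → ℝ) {i j : Fin 3} (hij : i ≠ j) :
    (Finset.univ.expect fun g => stepVector d α g x i * stepVector d α g x j) =
      (d 0 * d 1 + d 1 * d 2 + d 2 * d 0) / 3 * (x i * x j) := by
  have h1 : (Finset.univ.expect fun g => d (gateIndex g i) * d (gateIndex g j)) =
      (d 0 * d 1 + d 1 * d 2 + d 2 * d 0) / 3 :=
    expect_of_cyclic (f := fun π => d (π i) * d (π j)) fun π hπ => by
      have hne := hπ.ne hij
      dsimp only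
      generalize π i = k at *
      generalize π j = l at *
      fin_cases k <;> fin_cases l <;> simp at hne ⊢ <;> ring
  have hexp : ∀ g, stepVector d α g x i * stepVector d α g x j =
      d (gateIndex g i) * d (gateIndex g j) * (x i * x j) +
      gateSign g j * (x i * d (gateIndex g i) * α (gateIndex g j)) +
      gateSign g i * (x j * d (gateIndex g j) * α (gateIndex g i)) +
      gateSign g i * gateSign g j * (α (gateIndex g i) * α (gateIndex g j)) := fun g => by
    simp only [stepVector]
    ring
  simp only [hexp]
  rw [Finset.expect_add_distrib, Finset.expect_add_distrib, Finset.expect_add_distrib,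
    ← Finset.expect_mul, h1, expect_gateSign_mul (fun π => x i * d (π i) * α (π j)) j,
    expect_gateSign_mul (fun π => x j * d (π j) * α (π i)) i,
    expect_gateSign_mul_gateSign_mul (fun π => α (π i) * α (π j)) hij, add_zero, add_zero, add_zero]

theorem expect_sum_stepVector (d α e x : Fin 3 → ℝ) :
    (Finset.univ.expect fun g => ∑ i, e i * stepVector d α g x i) =
      (∑ k, d k) / 3 * ∑ i, e i * x i := by
  rw [Finset.expect_sum_comm, Finset.mul_sum]
  refine Finset.sum_congr rfl fun i _ => ?_
  rw [← Finset.mul_expect, expect_stepVector]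
  ring

theorem expect_sum_stepVector_sq (d α e x : Fin 3 → ℝ) :
    (Finset.univ.expect fun g => ∑ i, e i ^ 2 * stepVector d α g x i ^ 2) =
      (∑ k, d k ^ 2) / 3 * ∑ i, e i ^ 2 * x i ^ 2 + (∑ k, α k ^ 2) / 3 * ∑ i, e i ^ 2 := by
  rw [Finset.expect_sum_comm, Finset.mul_sum, Finset.mul_sum, ← Finset.sum_add_distrib]
  refine Finset.sum_congr rfl fun i _ => ?_
  rw [← Finset.mul_expect, expect_stepVector_sq]
  ring

/-- The off-diagonal part of the square of a linear form. -/
def offDiag (e x : Fin 3 → ℝ) : ℝ :=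
  2 * (e 0 * e 1) * (x 0 * x 1) + 2 * (e 1 * e 2) * (x 1 * x 2) + 2 * (e 2 * e 0) * (x 2 * x 0)

/-- The two parts have to be separated because a twirl scales them by different factors. -/
theorem sum_mul_sq_eq (e x : Fin 3 → ℝ) :
    (∑ i, e i * x i) ^ 2 = ∑ i, e i ^ 2 * x i ^ 2 + offDiag e x := by
  simp only [Fin.sum_univ_three, offDiag]
  ring

theorem expect_offDiag_stepVector (d α e x : Fin 3 → ℝ) :
    (Finset.univ.expect fun g => offDiag e (stepVector d α g x)) =
      (d 0 * d 1 + d 1 * d 2 + d 2 * d 0) / 3 * offDiag e x := by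
  simp only [offDiag]
  rw [Finset.expect_add_distrib, Finset.expect_add_distrib, ← Finset.mul_expect,
    ← Finset.mul_expect, ← Finset.mul_expect, expect_stepVector_mul _ _ _ (by decide),
    expect_stepVector_mul _ _ _ (by decide), expect_stepVector_mul _ _ _ (by decide)]
  ring

/-! ### The first two moments of the survival probability -/

theorem expect_alignedOp {Λ : SuperOp} {d α : Fin 3 → ℝ} (h : IsDiagonal Λ d α) {E : Op}
    (hE : E.IsHermitian) (m : ℕ) (x : Fin 3 → ℝ) :
    (Finset.univ.expect fun s : Fin m → cliffordGroup =>
      (E * alignedOp Λ s (bloch x)).trace.re) =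
      E.trace.re / 2 + ((∑ k, d k) / 3) ^ m * ∑ i, coord i E / 2 * x i := by
  induction m generalizing x with
  | zero => simp [alignedOp, gate_one, trace_mul_bloch hE]
  | succ m ih =>
    rw [expect_alignedOp_succ Λ m fun T => (E * T (bloch x)).trace.re]
    have hT : ∀ (g : cliffordGroup) (s : Fin m → cliffordGroup),
        (alignedOp Λ s * (gate g⁻¹ * Λ * gate g)) (bloch x) =
        alignedOp Λ s (bloch (stepVector d α g x)) := fun g s => by
      rw [Module.End.mul_apply, twirl_apply_bloch h]
    simp only [hT, ih]
    rw [Finset.expect_add_distrib, Fintype.expect_const, ← Finset.mul_expect,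
      expect_sum_stepVector d α fun i => coord i E / 2]
    ring

/-- Induction peels off the first noise, with the Bloch vector arbitrary. Its translation adds the
mean of `α ^ 2` to the diagonal part, which the remaining `m` steps damp by the `m`-th power: the
new term of the geometric sum. -/
theorem expect_alignedOp_sq {Λ : SuperOp} {d α : Fin 3 → ℝ} (h : IsDiagonal Λ d α) {E : Op}
    (hE : E.IsHermitian) (m : ℕ) (x : Fin 3 → ℝ) :
    (Finset.univ.expect fun s : Fin m → cliffordGroup =>
      (E * alignedOp Λ s (bloch x)).trace.re ^ 2) =
      (E.trace.re / 2) ^ 2 +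
      E.trace.re * ((∑ k, d k) / 3) ^ m * ∑ i, coord i E / 2 * x i +
      ((∑ k, d k ^ 2) / 3) ^ m * ∑ i, (coord i E / 2) ^ 2 * x i ^ 2 +
      ((d 0 * d 1 + d 1 * d 2 + d 2 * d 0) / 3) ^ m * offDiag (fun i => coord i E / 2) x +
      (∑ k, α k ^ 2) / 3 * (∑ i, (coord i E / 2) ^ 2) *
        ∑ t ∈ Finset.range m, ((∑ k, d k ^ 2) / 3) ^ t := by
  induction m generalizing x with
  | zero =>
    have := sum_mul_sq_eq (fun i => coord i E / 2) x
    simp [alignedOp, gate_one, trace_mul_bloch hE]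
    linear_combination this
  | succ m ih =>
    rw [expect_alignedOp_succ Λ m fun T => (E * T (bloch x)).trace.re ^ 2]
    have hT : ∀ (g : cliffordGroup) (s : Fin m → cliffordGroup),
        (alignedOp Λ s * (gate g⁻¹ * Λ * gate g)) (bloch x) =
        alignedOp Λ s (bloch (stepVector d α g x)) := fun g s => by
      rw [Module.End.mul_apply, twirl_apply_bloch h]
    simp only [hT, ih]
    rw [Finset.expect_add_distrib, Finset.expect_add_distrib, Finset.expect_add_distrib,
      Finset.expect_add_distrib, Fintype.expect_const, Fintype.expect_const, ← Finset.mul_expect,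
      ← Finset.mul_expect, ← Finset.mul_expect,
      expect_sum_stepVector d α fun i => coord i E / 2,
      expect_sum_stepVector_sq d α fun i => coord i E / 2, expect_offDiag_stepVector,
      Finset.sum_range_succ]
    ring

/-- The variance of the survival probability in closed form. -/
theorem rbVariance_eq {Λ₀ Λ : SuperOp} {d α : Fin 3 → ℝ} (h : IsDiagonal Λ d α) {E ρ : Op}
    (hE : E.IsHermitian) (m : ℕ) {x : Fin 3 → ℝ} (hx : Λ₀ ρ = bloch x) :
    rbVariance (constNoise m Λ₀ Λ) ρ E =
      (((∑ k, d k ^ 2) / 3) ^ m - (((∑ k, d k) / 3) ^ 2) ^ m) *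
        ∑ i, (coord i E / 2) ^ 2 * x i ^ 2 +
      (((d 0 * d 1 + d 1 * d 2 + d 2 * d 0) / 3) ^ m - (((∑ k, d k) / 3) ^ 2) ^ m) *
        offDiag (fun i => coord i E / 2) x +
      (∑ k, α k ^ 2) / 3 * (∑ i, (coord i E / 2) ^ 2) *
        ∑ t ∈ Finset.range m, ((∑ k, d k ^ 2) / 3) ^ t := by
  have hF : ∀ s : Fin m → cliffordGroup, survivalProb (constNoise m Λ₀ Λ) ρ E s =
      (E * alignedOp Λ s (bloch x)).trace.re := fun s => by
    rw [survivalProb, sequenceOp_constNoise, Module.End.mul_apply, hx]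
  have h1 := expect_alignedOp h hE m x
  have h2 := expect_alignedOp_sq h hE m x
  have h3 := sum_mul_sq_eq (fun i => coord i E / 2) x
  have hvar : ∀ f : (Fin m → cliffordGroup) → ℝ,
      (Finset.univ.expect fun s => (f s - Finset.univ.expect f) ^ 2) =
        (Finset.univ.expect fun s => f s ^ 2) - (Finset.univ.expect f) ^ 2 := fun f => by
    simp only [sub_sq]
    rw [Finset.expect_add_distrib, Finset.expect_sub_distrib, Fintype.expect_const,
      ← Finset.expect_mul, ← Finset.mul_expect]
    ring
  simp only [rbVariance, rbMean, hF]
  rw [hvar, h1, h2, pow_right_comm]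
  -- The constant and linear terms cancel; splitting the squared mean into diagonal and off-diagonal
  -- parts pairs it with the two second-moment terms.
  linear_combination (-(((∑ k, d k) / 3) ^ m) ^ 2) * h3

/-! ### The variance bound -/

theorem IsCPTP.map_posSemidef {Λ : SuperOp} (hΛ : IsCPTP Λ) {A : Op} (hA : A.PosSemidef) :
    (Λ A).PosSemidef :=
  (hΛ.completelyPositive 1 _ (hA.submatrix (Prod.snd : Fin 1 × Fin 2 → Fin 2))).submatrix
    fun a : Fin 2 => ((0 : Fin 1), a)

theorem IsEffect.sum_coord_sq_le {E : Op} (hE : IsEffect E) :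
    ∑ k, (coord k E / 2) ^ 2 ≤ 1 / 4 := by
  obtain ⟨h1, h2⟩ := RandomizedBenchmarking.sum_coord_sq_le hE.posSemidef
  obtain ⟨h3, h4⟩ := RandomizedBenchmarking.sum_coord_sq_le hE.one_sub_posSemidef
  have hc : ∀ k, coord k (1 - E) = -coord k E := fun k => by
    simp [coord, mul_sub, trace_sigma]
  simp only [hc, neg_sq, Matrix.trace_sub, Matrix.trace_one, Fintype.card_fin, Nat.cast_ofNat,
    Complex.sub_re, Complex.re_ofNat] at h3 h4
  simp only [div_pow, ← Finset.sum_div]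
  -- The coordinate vector is no longer than either `tr E` or `2 - tr E`, and one of these is at
  -- most `1`.
  rcases le_total E.trace.re 1 with h | h <;> nlinarith

theorem abs_pow_sub_pow_le_mul {a b : ℝ} (ha : |a| ≤ 1) (hb : |b| ≤ 1) (m : ℕ) :
    |a ^ m - b ^ m| ≤ m * |a - b| := by
  refine (abs_pow_sub_pow_le a b m).trans ?_
  have : max |a| |b| ^ (m - 1) ≤ 1 := pow_le_one₀ (le_max_of_le_left (abs_nonneg a)) (max_le ha hb)
  calc |a - b| * m * max |a| |b| ^ (m - 1) ≤ |a - b| * m * 1 := by gcongr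
    _ = m * |a - b| := by ring

theorem geom_sum_le {a : ℝ} (h0 : 0 ≤ a) (h1 : a ≤ 1) (m : ℕ) :
    ∑ t ∈ Finset.range m, a ^ t ≤ m := by
  calc ∑ t ∈ Finset.range m, a ^ t ≤ ∑ _t ∈ Finset.range m, (1 : ℝ) :=
        Finset.sum_le_sum fun t _ => pow_le_one₀ h0 h1
    _ = m := by simp

/-- Complete positivity bounds the moments of the noise parameters by the infidelity. -/
theorem IsDiagonal.moment_bounds {Λ : SuperOp} {d α : Fin 3 → ℝ} (h : IsDiagonal Λ d α)
    (hΛ : IsCPTP Λ) :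
    |((∑ k, d k) / 3) ^ 2| ≤ 1 ∧ |(∑ k, d k ^ 2) / 3| ≤ 1 ∧
    |(d 0 * d 1 + d 1 * d 2 + d 2 * d 0) / 3| ≤ 1 ∧
    |(∑ k, d k ^ 2) / 3 - ((∑ k, d k) / 3) ^ 2| ≤ 2 * infidelity Λ ^ 2 ∧
    |(d 0 * d 1 + d 1 * d 2 + d 2 * d 0) / 3 - ((∑ k, d k) / 3) ^ 2| ≤ infidelity Λ ^ 2 ∧
    (∑ k, α k ^ 2) / 3 ≤ 6 * infidelity Λ ^ 2 := by
  obtain ⟨⟨b0, b1, b2, b3⟩, hα⟩ := h.constraints hΛ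
  have hα2 : ∀ k, α k ^ 2 ≤ (1 - d k) ^ 2 := fun k =>
    sq_le_sq' (abs_le.1 (hα k)).1 (abs_le.1 (hα k)).2
  have u0 := (abs_nonneg _).trans (hα 0)
  have u1 := (abs_nonneg _).trans (hα 1)
  have u2 := (abs_nonneg _).trans (hα 2)
  have a0 := hα2 0
  have a1 := hα2 1
  have a2 := hα2 2
  rw [infidelity_eq h.apply_bloch]
  simp only [Fin.sum_univ_three]
  generalize d 0 = a at *
  generalize d 1 = b at *
  generalize d 2 = c at *
  have ha : a ^ 2 ≤ 1 := (sq_le_one_iff_abs_le_one a).2 (abs_le.2 ⟨by linarith, by linarith⟩)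
  have hb : b ^ 2 ≤ 1 := (sq_le_one_iff_abs_le_one b).2 (abs_le.2 ⟨by linarith, by linarith⟩)
  have hc : c ^ 2 ≤ 1 := (sq_le_one_iff_abs_le_one c).2 (abs_le.2 ⟨by linarith, by linarith⟩)
  have s1 := sq_nonneg (a - b)
  have s2 := sq_nonneg (b - c)
  have s3 := sq_nonneg (c - a)
  have s4 := sq_nonneg (a + b + c)
  -- With `u = 1 - d`, the constraints `b1`, `b2`, `b3` say that each `u` is at most the sum of the
  -- other two. Multiplying by that `u` and adding gives `∑ u² ≤ (∑ u)² / 2`, that is `∑ u² ≤ 18r²`,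
  -- since `∑ u = 6r`.
  have m1 := mul_nonneg u0 b1
  have m2 := mul_nonneg u1 b2
  have m3 := mul_nonneg u2 b3
  have hsum : (1 - a) ^ 2 + (1 - b) ^ 2 + (1 - c) ^ 2 ≤ (3 - (a + b + c)) ^ 2 / 2 := by linarith
  have s5 := sq_nonneg (3 - (a + b + c))
  -- Here `s - p²` is the variance of `u`, at most `6r² - (2r)²`; `q - p²` is minus half of it, as
  -- `s + 2q = 3p²`; and `α² ≤ u²` termwise.
  refine ⟨abs_le.2 ⟨?_, ?_⟩, abs_le.2 ⟨?_, ?_⟩, abs_le.2 ⟨?_, ?_⟩, abs_le.2 ⟨?_, ?_⟩,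
    abs_le.2 ⟨?_, ?_⟩, ?_⟩ <;> clear h hα hα2 <;> linarith [sq_nonneg a, sq_nonneg b, sq_nonneg c]

theorem rbVariance_le {Λ₀ Λ : SuperOp} (hΛ₀ : IsCPTP Λ₀) (hΛ : IsCPTP Λ)
    (hdiag : (unitalBlock Λ).IsDiag) {ρ E : Op} (hρ : IsState ρ) (hE : IsEffect E) (m : ℕ) :
    rbVariance (constNoise m Λ₀ Λ) ρ E ≤ 9 / 4 * m * infidelity Λ ^ 2 := by
  obtain ⟨d, α, h⟩ := exists_isDiagonal hΛ hdiag
  have hρ' := hΛ₀.map_posSemidef hρ.posSemidef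
  have htr : (Λ₀ ρ).trace = 1 := by rw [hΛ₀.trace_map, hρ.trace_eq_one]
  rw [rbVariance_eq h hE.posSemidef.isHermitian m
    (eq_bloch_of_isHermitian hρ'.isHermitian htr)]
  have hx : ∑ k, coord k (Λ₀ ρ) ^ 2 ≤ 1 := by simpa [htr] using (sum_coord_sq_le hρ').2
  have he := hE.sum_coord_sq_le
  obtain ⟨hp, hs, hq, hsp, hqp, hα⟩ := h.moment_bounds hΛ
  have hs0 : 0 ≤ (∑ k, d k ^ 2) / 3 := by positivity
  have hα0 : 0 ≤ (∑ k, α k ^ 2) / 3 := by positivity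
  have hdiag := sum_mul_sq_eq (fun k => coord k E / 2) fun k => coord k (Λ₀ ρ)
  have hcs := Finset.sum_mul_sq_le_sq_mul_sq Finset.univ (fun k => coord k E / 2)
    fun k => coord k (Λ₀ ρ)
  have hE0 : 0 ≤ ∑ k, (coord k E / 2) ^ 2 := by positivity
  have hA0 : 0 ≤ ∑ k, (coord k E / 2) ^ 2 * coord k (Λ₀ ρ) ^ 2 := by positivity
  have hA1 : ∑ k, (coord k E / 2) ^ 2 * coord k (Λ₀ ρ) ^ 2 ≤ ∑ k, (coord k E / 2) ^ 2 :=
    Finset.sum_le_sum fun k _ => mul_le_of_le_one_right (sq_nonneg _) <|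
      (Finset.single_le_sum (f := fun k => coord k (Λ₀ ρ) ^ 2) (fun _ _ => sq_nonneg _)
        (Finset.mem_univ k)).trans hx
  have hb : (∑ k, coord k E / 2 * coord k (Λ₀ ρ)) ^ 2 ≤ 1 / 4 :=
    hcs.trans ((mul_le_of_le_one_right hE0 hx).trans he)
  have hb0 := sq_nonneg (∑ k, coord k E / 2 * coord k (Λ₀ ρ))
  -- The off-diagonal part is a difference of two numbers in `[0, 1/4]`: the squared linear form and
  -- its diagonal part.
  have hB : |offDiag (fun k => coord k E / 2) fun k => coord k (Λ₀ ρ)| ≤ 1 / 4 :=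
    abs_le.2 ⟨by linarith, by linarith⟩
  have hA : |∑ k, (coord k E / 2) ^ 2 * coord k (Λ₀ ρ) ^ 2| ≤ 1 / 4 :=
    abs_le.2 ⟨by linarith, by linarith⟩
  have hm : (0 : ℝ) ≤ m := m.cast_nonneg
  have t1 := (abs_pow_sub_pow_le_mul hs hp m).trans (mul_le_mul_of_nonneg_left hsp hm)
  have t2 := (abs_pow_sub_pow_le_mul hq hp m).trans (mul_le_mul_of_nonneg_left hqp hm)
  have t3 := geom_sum_le hs0 (abs_le.1 hs).2 m
  have f1 := (le_abs_self _).trans ((abs_mul _ _).trans_le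
    (mul_le_mul t1 hA (abs_nonneg _) ((abs_nonneg _).trans t1)))
  have f2 := (le_abs_self _).trans ((abs_mul _ _).trans_le
    (mul_le_mul t2 hB (abs_nonneg _) ((abs_nonneg _).trans t2)))
  have f3 := mul_le_mul (mul_le_mul hα he hE0 (hα0.trans hα)) t3
    (Finset.sum_nonneg fun t _ => pow_nonneg hs0 t)
    (mul_nonneg (hα0.trans hα) (by norm_num))
  refine (add_le_add (add_le_add f1 f2) f3).trans (le_of_eq ?_)
  ring

end RandomizedBenchmarking

end

theorem mainTheorem6 :
    ∃ C : ℝ, ∀ Λ₀ Λ : RandomizedBenchmarking.SuperOp,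
      RandomizedBenchmarking.IsCPTP Λ₀ → RandomizedBenchmarking.IsCPTP Λ →
      (RandomizedBenchmarking.unitalBlock Λ).IsDiag →
      ∀ ρ E : RandomizedBenchmarking.Op,
        RandomizedBenchmarking.IsState ρ → RandomizedBenchmarking.IsEffect E →
        ∀ m : ℕ,
          RandomizedBenchmarking.rbVariance
              (RandomizedBenchmarking.constNoise m Λ₀ Λ) ρ E ≤
            11 / 4 * m * RandomizedBenchmarking.infidelity Λ ^ 2 +
              C * (m ^ 2 * RandomizedBenchmarking.infidelity Λ ^ 3) := by
  -- The constant `9/4` already lies below `11/4`, so no cubic correction is needed.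
  refine ⟨0, fun Λ₀ Λ hΛ₀ hΛ hdiag ρ E hρ hE m => ?_⟩
  refine (RandomizedBenchmarking.rbVariance_le hΛ₀ hΛ hdiag hρ hE m).trans ?_
  have : 0 ≤ m * RandomizedBenchmarking.infidelity Λ ^ 2 := by positivity
  linarith
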